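/- Let $K$ be a field, $S=K[x_1,\dots,x_n]$ with the standard grading, and let $I\subseteq S$ be a squarefree monomial ideal (an ideal generated by squarefree monomials) with minimal set of monomial generators $G(I)=\{u_1,\dots,u_p\}$. Write $\operatorname{supp}(u)=\{i : x_i \mid u\}$ and let $\beta_{i,j}(I)$ be the graded Betti numbers of $I$, that is, $F_i=\bigoplus_j S(-j)^{\beta_{i,j}(I)}$ in the minimal graded free resolution $\cdots\to F_1\to F_0\to I\to 0$; put $\operatorname{pd}(I)=\max\{i:\beta_{i,j}(I)\neq0 \text{ for some } j\}$ and $\operatorname{reg}(I)=\max\{j-i:\beta_{i,j}(I)\neq 0\}$. Define - the support index $s$ of $I$: the smallest $i\ge 0$ such that $\bigcup_{\ell=1}^{i+1}\operatorname{supp}(u_{j_\ell})=\bigcup_{\ell=1}^{p}\operatorname{supp}(u_\ell)$ for all $1\le j_1<\dots<j_{i+1}\le p$; - $\operatorname{bcos}_S(I)$: the smallest $\ell\ge1$ such that $\operatorname{lcm}(u_{j_1},\dots,u_{j_\ell})=\operatorname{lcm}(u_1,\dots,u_p)$ for all $1\le j_1<\dots<j_\ell\le p$; - $\operatorname{cosize}(I)=\deg\operatorname{lcm}(u_1,\dots,u_p)-w$,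 where $w$ is the smallest $\ell\ge1$ such that $\operatorname{lcm}(u_{j_1},\dots,u_{j_\ell})=\operatorname{lcm}(u_1,\dots,u_p)$ for some $1\le j_1<\dots<j_\ell\le p$. (For $I=0$ we put $\operatorname{pd}(I)=\operatorname{reg}(I)=-\infty$ and $w=0$.) Then $s=\operatorname{bcos}_S(I)-1$, and (a) $\operatorname{pd}(I)\le\min\{s,n\}=\min\{\operatorname{bcos}_S(I)-1,n\}$; (b) $\operatorname{reg}(I)\le\operatorname{cosize}(I)+1$. -/

import Mathlib

open MvPolynomial

-- The standard grading of a polynomial ring.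
attribute [local instance] MvPolynomial.gradedAlgebra

namespace SquarefreeBounds

noncomputable section

/-- In the graded free module `⨁ₐ S(-deg a)`, `S = K[x₁,…,xₙ]`, the vector `v` is homogeneous of
degree `k`: every monomial `m` of its coordinate `v a` satisfies `deg m + deg a = k`. -/
def IsHomogeneousVec {K : Type*} [Field K] {n r : ℕ} (deg : Fin r → ℕ) (k : ℕ)
    (v : Fin r → MvPolynomial (Fin n) K) : Prop :=
  ∀ a, ∀ m ∈ (v a).support, m.degree + deg a = k

/-- A graded free resolution `⋯ → F₁ → F₀ → I → 0` of an ideal `I` of `S = K[x₁,…,xₙ]` with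
`Fᵢ = ⨁ₐ S(-deg i a)`, where `a` runs over `Fin (rank i)`, and all maps homogeneous of degree `0`.
The augmentation `ε` is regarded as a map to `S` with image `I`. -/
structure GradedFreeResolution {K : Type*} [Field K] {n : ℕ}
    (I : Ideal (MvPolynomial (Fin n) K)) where
  rank : ℕ → ℕ
  deg : ∀ i, Fin (rank i) → ℕ
  ε : (Fin (rank 0) → MvPolynomial (Fin n) K) →ₗ[MvPolynomial (Fin n) K] MvPolynomial (Fin n) K
  d : ∀ i, (Fin (rank (i + 1)) → MvPolynomial (Fin n) K) →ₗ[MvPolynomial (Fin n) K]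
    (Fin (rank i) → MvPolynomial (Fin n) K)
  ε_homogeneous : ∀ a, (ε (Pi.single a 1)).IsHomogeneous (deg 0 a)
  d_homogeneous : ∀ i a, IsHomogeneousVec (deg i) (deg (i + 1) a) (d i (Pi.single a 1))
  range_ε : LinearMap.range ε = I
  exact_zero : LinearMap.range (d 0) = LinearMap.ker ε
  exact_succ : ∀ i, LinearMap.range (d (i + 1)) = LinearMap.ker (d i)

/-- The resolution is minimal: `d(Fᵢ₊₁) ⊆ 𝔪 Fᵢ` for all `i`, with `𝔪 = (x₁,…,xₙ)`. -/
def GradedFreeResolution.IsMinimal {K : Type*} [Field K] {n : ℕ}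
    {I : Ideal (MvPolynomial (Fin n) K)} (F : GradedFreeResolution I) : Prop :=
  ∀ i v a, F.d i v a ∈ idealOfVars (Fin n) K

/-- The number of summands `S(-j)` of `Fᵢ`. -/
def GradedFreeResolution.betti {K : Type*} [Field K] {n : ℕ}
    {I : Ideal (MvPolynomial (Fin n) K)} (F : GradedFreeResolution I) (i j : ℕ) : ℕ :=
  (Finset.univ.filter fun a => F.deg i a = j).card

section Existence

variable {K : Type*} [Field K] {n : ℕ}

/-- The degree `k` component of a vector of `⨁ₐ S(-deg a)`. -/
def vecComponent {r : ℕ} (deg : Fin r → ℕ) (k : ℕ) (v : Fin r → MvPolynomial (Fin n) K) :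
    Fin r → MvPolynomial (Fin n) K :=
  fun a => if deg a ≤ k then homogeneousComponent (k - deg a) (v a) else 0

theorem coeff_vecComponent {r : ℕ} (deg : Fin r → ℕ) (k : ℕ)
    (v : Fin r → MvPolynomial (Fin n) K) (a : Fin r) (m : Fin n →₀ ℕ) :
    coeff m (vecComponent deg k v a) = if m.degree + deg a = k then coeff m (v a) else 0 := by
  unfold vecComponent
  split_ifs with h1 h2 h2
  · rw [coeff_homogeneousComponent, if_pos (by omega)]
  · rw [coeff_homogeneousComponent, if_neg (by omega)]
  · omega
  · simp

theorem vecComponent_homogeneous {r : ℕ} (deg : Fin r → ℕ) (k : ℕ)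
    (v : Fin r → MvPolynomial (Fin n) K) : IsHomogeneousVec deg k (vecComponent deg k v) := by
  intro a m hm
  rw [mem_support_iff, coeff_vecComponent] at hm
  by_contra h
  exact hm (if_neg h)

theorem exists_sum_vecComponent {r : ℕ} (deg : Fin r → ℕ) (v : Fin r → MvPolynomial (Fin n) K) :
    ∃ N : ℕ, v = ∑ k ∈ Finset.range N, vecComponent deg k v := by
  refine ⟨(Finset.univ.sup fun a => (v a).totalDegree + deg a) + 1, ?_⟩
  funext a
  ext m
  rw [Finset.sum_apply, coeff_sum]
  simp only [coeff_vecComponent]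
  rw [Finset.sum_ite_eq]
  split_ifs with h
  · rfl
  · by_contra hc
    apply h
    rw [Finset.mem_range, Nat.lt_succ_iff]
    refine le_trans ?_ (Finset.le_sup (f := fun a => (v a).totalDegree + deg a)
      (Finset.mem_univ a))
    have := le_totalDegree (mem_support_iff.mpr hc)
    have h2 : m.degree = m.sum fun _ e => e := rfl
    show m.degree + deg a ≤ (v a).totalDegree + deg a
    omega

/-- Homogeneous maps commute with taking components. -/
theorem map_vecComponent {r r' : ℕ} (deg : Fin r → ℕ) (deg' : Fin r' → ℕ)
    (φ : (Fin r' → MvPolynomial (Fin n) K) →ₗ[MvPolynomial (Fin n) K]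
      (Fin r → MvPolynomial (Fin n) K))
    (hφ : ∀ b, IsHomogeneousVec deg (deg' b) (φ (Pi.single b 1))) (k : ℕ)
    (v : Fin r' → MvPolynomial (Fin n) K) :
    φ (vecComponent deg' k v) = vecComponent deg k (φ v) := by
  have key : ∀ w : Fin r' → MvPolynomial (Fin n) K,
      φ w = ∑ b, w b • φ (Pi.single b 1) := by
    intro w
    refine Eq.trans (LinearMap.pi_apply_eq_sum_univ φ w) ?_
    refine Finset.sum_congr rfl fun b _ => ?_
    congr 2
    funext c
    simp [Pi.single_apply, eq_comm]
  rw [key, key v]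
  funext a
  ext m
  rw [coeff_vecComponent]
  simp only [Finset.sum_apply, Pi.smul_apply, smul_eq_mul, coeff_sum, coeff_mul]
  have : ∀ (b : Fin r') (x : (Fin n →₀ ℕ) × (Fin n →₀ ℕ)), x ∈ Finset.HasAntidiagonal.antidiagonal m →
      coeff x.1 (vecComponent deg' k v b) * coeff x.2 (φ (Pi.single b 1) a) =
      if m.degree + deg a = k then coeff x.1 (v b) * coeff x.2 (φ (Pi.single b 1) a) else 0 := by
    intro b x hx
    rw [coeff_vecComponent]
    by_cases h0 : coeff x.2 (φ (Pi.single b 1) a) = 0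
    · simp [h0]
    · have h1 := hφ b a x.2 (mem_support_iff.mpr h0)
      have h2 : m.degree = x.1.degree + x.2.degree := by
        rw [← Finset.HasAntidiagonal.mem_antidiagonal.mp hx, map_add]
      have h3 : x.1.degree + deg' b = k ↔ m.degree + deg a = k := by omega
      simp only [h3]
      split_ifs <;> simp
  rw [Finset.sum_congr rfl fun b _ => Finset.sum_congr rfl (this b)]
  split_ifs <;> simp

/-- A submodule of a graded free module spanned by homogeneous elements is the image of a
homogeneous map from a graded free module whose kernel lies in `𝔪 F` and is again spanned by
homogeneous elements. -/
theorem exists_minimal_cover {r : ℕ} (deg : Fin r → ℕ)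
    (N : Submodule (MvPolynomial (Fin n) K) (Fin r → MvPolynomial (Fin n) K))
    (hN : N = Submodule.span _ {v | v ∈ N ∧ ∃ k, IsHomogeneousVec deg k v}) :
    ∃ (r' : ℕ) (deg' : Fin r' → ℕ)
      (φ : (Fin r' → MvPolynomial (Fin n) K) →ₗ[MvPolynomial (Fin n) K]
        (Fin r → MvPolynomial (Fin n) K)),
      (∀ b, IsHomogeneousVec deg (deg' b) (φ (Pi.single b 1))) ∧
      LinearMap.range φ = N ∧
      (∀ v ∈ LinearMap.ker φ, ∀ a,
        v a ∈ idealOfVars (Fin n) K) ∧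
      LinearMap.ker φ =
        Submodule.span _ {v | v ∈ LinearMap.ker φ ∧ ∃ k, IsHomogeneousVec deg' k v} := by
  classical
  have hfg : N.FG := IsNoetherian.noetherian N
  rw [hN] at hfg
  obtain ⟨T, hTsub, hT⟩ := Submodule.fg_span_iff_fg_span_finset_subset _ |>.mp hfg
  have hex : ∃ r', ∃ u : Fin r' → (Fin r → MvPolynomial (Fin n) K),
      (∀ b, ∃ k, IsHomogeneousVec deg k (u b)) ∧ Submodule.span _ (Set.range u) = N := by
    refine ⟨T.card, fun b => (T.equivFin.symm b : Fin r → MvPolynomial (Fin n) K), ?_, ?_⟩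
    · intro b
      exact (hTsub (T.equivFin.symm b).2).2
    · have : Set.range (fun b => (T.equivFin.symm b : Fin r → MvPolynomial (Fin n) K)) = T := by
        ext x
        constructor
        · rintro ⟨b, rfl⟩
          exact (T.equivFin.symm b).2
        · intro hx
          exact ⟨T.equivFin ⟨x, hx⟩, by simp⟩
      rw [this, hN]
      exact hT.symm
  obtain ⟨u, hu, hspan⟩ := Nat.find_spec hex
  have hmin : ∀ m, m < Nat.find hex → _ := fun m hm => Nat.find_min hex hm
  generalize Nat.find hex = r' at u hu hspan hmin
  choose deg' hdeg' using hu
  let φ := Fintype.linearCombination (MvPolynomial (Fin n) K) u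
  have hφ1 : ∀ b, φ (Pi.single b 1) = u b := fun b => by
    simp [φ, Fintype.linearCombination_apply_single]
  have hφh : ∀ b, IsHomogeneousVec deg (deg' b) (φ (Pi.single b 1)) := fun b => by
    rw [hφ1]; exact hdeg' b
  have hcomp : ∀ v ∈ LinearMap.ker φ, ∀ k, vecComponent deg' k v ∈ LinearMap.ker φ := by
    intro v hv k
    rw [LinearMap.mem_ker] at hv ⊢
    rw [map_vecComponent deg deg' φ hφh, hv]
    funext a
    ext m
    rw [coeff_vecComponent]
    simp
  refine ⟨r', deg', φ, hφh, ?_, ?_, ?_⟩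
  · rw [← hspan]
    exact Fintype.range_linearCombination _ _
  · intro v hv b
    rw [idealOfVars, ← Set.image_univ, mem_ideal_span_X_image]
    suffices hc : constantCoeff (v b) = 0 by
      intro m hm
      have hm0 : m ≠ 0 := by
        rintro rfl
        exact mem_support_iff.mp hm hc
      obtain ⟨i, hi⟩ := Finsupp.ne_iff.mp hm0
      exact ⟨i, Set.mem_univ i, hi⟩
    by_contra hc
    have hw := hcomp v hv (deg' b)
    set w := vecComponent deg' (deg' b) v with hwdef
    have hwb : w b = C (constantCoeff (v b)) := by
      ext m
      rw [hwdef, coeff_vecComponent, coeff_C]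
      by_cases h0 : m = 0
      · subst h0
        simp [constantCoeff_eq]
      · have : m.degree ≠ 0 := mt (Finsupp.degree_eq_zero_iff m).mp h0
        rw [if_neg (by omega), if_neg (Ne.symm h0)]
    cases r' with
    | zero => exact b.elim0
    | succ q =>
      refine hmin q (Nat.lt_succ_self q) ⟨fun c => u (b.succAbove c),
        fun c => ⟨_, hdeg' _⟩, ?_⟩
      rw [← hspan]
      apply le_antisymm
      · apply Submodule.span_mono
        rintro _ ⟨c, rfl⟩
        exact ⟨_, rfl⟩
      · rw [Submodule.span_le]
        rintro _ ⟨c, rfl⟩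
        rcases Fin.eq_self_or_eq_succAbove b c with rfl | ⟨c', rfl⟩
        · have h1 : ∑ e, w e • u e = 0 := by
            have := LinearMap.mem_ker.mp hw
            simpa [φ, Fintype.linearCombination_apply] using this
          rw [Fin.sum_univ_succAbove _ c, hwb] at h1
          have h2 : u c = (C (constantCoeff (v c))⁻¹ : MvPolynomial (Fin n) K) •
              ((C (constantCoeff (v c)) : MvPolynomial (Fin n) K) • u c) := by
            rw [smul_smul, ← C_mul, inv_mul_cancel₀ hc, C_1, one_smul]
          rw [h2, eq_neg_of_add_eq_zero_left h1]
          refine Submodule.smul_mem _ _ (Submodule.neg_mem _ (Submodule.sum_mem _ fun e _ => ?_))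
          exact Submodule.smul_mem _ _ (Submodule.subset_span ⟨e, rfl⟩)
        · exact Submodule.subset_span ⟨c', rfl⟩
  · apply le_antisymm
    · intro v hv
      obtain ⟨M, hM⟩ := exists_sum_vecComponent deg' v
      rw [hM]
      exact Submodule.sum_mem _ fun k _ => Submodule.subset_span
        ⟨hcomp v hv k, k, vecComponent_homogeneous deg' k v⟩
    · rw [Submodule.span_le]
      exact fun v hv => hv.1

/-- A step in the construction of a minimal resolution. -/
structure ResStep (K : Type*) [Field K] (n : ℕ) where
  r : ℕ
  deg : Fin r → ℕ
  N : Submodule (MvPolynomial (Fin n) K) (Fin r → MvPolynomial (Fin n) K)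
  hN : N = Submodule.span _ {v | v ∈ N ∧ ∃ k, IsHomogeneousVec deg k v}

theorem ResStep.exists_next (A : ResStep K n) : ∃ (B : ResStep K n)
    (φ : (Fin B.r → MvPolynomial (Fin n) K) →ₗ[MvPolynomial (Fin n) K]
        (Fin A.r → MvPolynomial (Fin n) K)),
      (∀ b, IsHomogeneousVec A.deg (B.deg b) (φ (Pi.single b 1))) ∧
      LinearMap.range φ = A.N ∧ LinearMap.ker φ = B.N ∧
      (∀ v ∈ B.N, ∀ a, v a ∈ idealOfVars (Fin n) K) := by
  obtain ⟨r', deg', φ, h1, h2, h3, h4⟩ := exists_minimal_cover A.deg A.N A.hN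
  exact ⟨⟨r', deg', LinearMap.ker φ, h4⟩, φ, h1, h2, rfl, h3⟩

/-- Every graded ideal has a minimal graded free resolution. -/
theorem exists_minimal_resolution (I : HomogeneousIdeal (homogeneousSubmodule (Fin n) K)) :
    ∃ F : GradedFreeResolution I.toIdeal, F.IsMinimal := by
  classical
  let π : (Fin 1 → MvPolynomial (Fin n) K) →ₗ[MvPolynomial (Fin n) K] MvPolynomial (Fin n) K :=
    LinearMap.proj 0
  let A₀ : ResStep K n :=
    { r := 1
      deg := fun _ => 0
      N := Submodule.comap π I.toIdeal
      hN := by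
        apply le_antisymm
        · intro v hv
          obtain ⟨M, hM⟩ := exists_sum_vecComponent (fun _ => 0) v
          rw [hM]
          refine Submodule.sum_mem _ fun k _ => Submodule.subset_span
            ⟨?_, k, vecComponent_homogeneous _ k v⟩
          have := (mem_iff_homogeneousComponent_mem I.isHomogeneous _).mp hv k
          simpa [π, vecComponent] using this
        · rw [Submodule.span_le]
          exact fun v hv => hv.1 }
  choose nxt φ h1 h2 h3 h4 using fun A : ResStep K n => A.exists_next
  let B : ℕ → ResStep K n := fun i => Nat.rec (nxt A₀) (fun _ A => nxt A) i
  have hπ : Function.Injective π := by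
    intro v w hvw
    funext a
    rw [Subsingleton.elim a 0]
    exact hvw
  refine ⟨⟨fun i => (B i).r, fun i => (B i).deg, π ∘ₗ φ A₀, fun i => φ (B i), ?_,
    fun i a => h1 (B i) a, ?_, ?_, ?_⟩, ?_⟩
  · intro a m hm
    have := h1 A₀ a 0 m (mem_support_iff.mpr hm)
    rw [show (1 : Fin n → ℕ) = fun _ => 1 from rfl, ← Finsupp.degree_eq_weight_one]
    exact this
  · rw [LinearMap.range_comp, h2 A₀]
    show Submodule.map π (Submodule.comap π I.toIdeal) = I.toIdeal
    rw [Submodule.map_comap_eq, inf_eq_right]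
    intro x _
    exact ⟨fun _ => x, rfl⟩
  · rw [LinearMap.ker_comp_of_ker_eq_bot _ (LinearMap.ker_eq_bot.mpr hπ), h2, h3]
    rfl
  · intro i
    rw [h2, h3]
  · intro i v a
    have hv : φ (B i) v ∈ (B i).N := by rw [← h2]; exact ⟨v, rfl⟩
    cases i with
    | zero => exact h4 A₀ _ hv a
    | succ i => exact h4 (B i) _ hv a

end Existence

/-- The minimal graded free resolution of a graded ideal. -/
def minimalResolution {K : Type*} [Field K] {n : ℕ}
    (I : HomogeneousIdeal (homogeneousSubmodule (Fin n) K)) : GradedFreeResolution I.toIdeal :=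
  (exists_minimal_resolution I).choose

/-- The graded Betti numbers `β_{i,j}(I)`. -/
def gradedBetti {K : Type*} [Field K] {n : ℕ}
    (I : HomogeneousIdeal (homogeneousSubmodule (Fin n) K)) (i j : ℕ) : ℕ :=
  (minimalResolution I).betti i j

/-- `pd(I) = max {i : β_{i,j}(I) ≠ 0 for some j}`; it is `⊥` for the zero ideal. -/
def projDim {K : Type*} [Field K] {n : ℕ}
    (I : HomogeneousIdeal (homogeneousSubmodule (Fin n) K)) : WithBot ℕ∞ :=
  sSup {x | ∃ i j : ℕ, gradedBetti I i j ≠ 0 ∧ x = (i : WithBot ℕ∞)}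

/-- `reg(I) = max {j - i : β_{i,j}(I) ≠ 0}`; it is `⊥` for the zero ideal. -/
def regularity {K : Type*} [Field K] {n : ℕ}
    (I : HomogeneousIdeal (homogeneousSubmodule (Fin n) K)) : WithBot (WithTop ℤ) :=
  sSup {x | ∃ i j : ℕ, gradedBetti I i j ≠ 0 ∧
    x = (((((j : ℤ) - (i : ℤ) : ℤ)) : WithTop ℤ) : WithBot (WithTop ℤ))}

/-- `I` is generated by squarefree monomials `x^u`, i.e. those with all exponents at most `1`. -/
def IsSquarefreeMonomialIdeal {K : Type*} [Field K] {n : ℕ}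
    (I : Ideal (MvPolynomial (Fin n) K)) : Prop :=
  ∃ A : Set (Fin n →₀ ℕ), (∀ u ∈ A, ∀ i, u i ≤ 1) ∧
    I = Ideal.span ((fun u => monomial u (1 : K)) '' A)

theorem minimalMonomials_finite {K : Type*} [Field K] {n : ℕ}
    (I : Ideal (MvPolynomial (Fin n) K)) :
    {u : Fin n →₀ ℕ | Minimal (fun v => monomial v (1 : K) ∈ I) u}.Finite := by
  apply WellQuasiOrderedLE.finite_of_isAntichain
  intro a ha b hb hab hle
  have hb' : Minimal (fun v => monomial v (1 : K) ∈ I) b := hb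
  exact hab (hb'.eq_of_le ha.1 hle)

/-- `G(I)`: the (exponent vectors of the) monomials of `I` that are minimal under divisibility,
which form the minimal set of monomial generators when `I` is a monomial ideal. -/
def minimalGens {K : Type*} [Field K] {n : ℕ} (I : Ideal (MvPolynomial (Fin n) K)) :
    Finset (Fin n →₀ ℕ) :=
  (minimalMonomials_finite I).toFinset

/-- `𝒜ᵢ`: the unions of the supports of `i + 1` distinct elements of `G(I)`. -/
def supportUnions {K : Type*} [Field K] {n : ℕ} (I : Ideal (MvPolynomial (Fin n) K)) (i : ℕ) :
    Set (Finset (Fin n)) :=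
  {A | ∃ T ⊆ minimalGens I, T.card = i + 1 ∧ A = T.biUnion Finsupp.support}

/-- The support index of `I`. -/
def supportIndex {K : Type*} [Field K] {n : ℕ} (I : Ideal (MvPolynomial (Fin n) K)) : ℕ :=
  sInf {i | ∀ A ∈ supportUnions I i, A = (minimalGens I).biUnion Finsupp.support}

/-- The (exponent vector of the) least common multiple of the monomials in `T`. -/
def monomialLcm {n : ℕ} (T : Finset (Fin n →₀ ℕ)) : Fin n →₀ ℕ :=
  T.sup id

/-- `bcos_S(I)`: the smallest `ℓ ≥ 1` such that any `ℓ` distinct elements of `G(I)` have the same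
least common multiple as all of `G(I)`. -/
def bcos {K : Type*} [Field K] {n : ℕ} (I : Ideal (MvPolynomial (Fin n) K)) : ℕ :=
  sInf {l | 1 ≤ l ∧ ∀ T ⊆ minimalGens I, T.card = l →
    monomialLcm T = monomialLcm (minimalGens I)}

/-- The smallest `ℓ ≥ 1` such that some `ℓ` distinct elements of `G(I)` have the same least common
multiple as all of `G(I)` (it is `0` for the zero ideal, where there is no such `ℓ`). -/
def minCoverSize {K : Type*} [Field K] {n : ℕ} (I : Ideal (MvPolynomial (Fin n) K)) : ℕ :=
  sInf {l | 1 ≤ l ∧ ∃ T ⊆ minimalGens I, T.card = l ∧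
    monomialLcm T = monomialLcm (minimalGens I)}

/-- The cosize of `I`: the degree of the least common multiple of `G(I)` minus `minCoverSize I`. -/
def cosize {K : Type*} [Field K] {n : ℕ} (I : Ideal (MvPolynomial (Fin n) K)) : ℤ :=
  ((monomialLcm (minimalGens I)).degree : ℤ) - (minCoverSize I : ℤ)

end

end SquarefreeBounds

/-! The graded Betti number β_{i,j}(I) is the dimension of Tor_i(I, K)_j, the Koszul homology H_i(x;
I)_j; only the implication "H_i(x; I)_j = 0 gives β_{i,j}(I) = 0" is needed. It rests on the
exactness of the Koszul complex of S (`koszul_exact`): dimension shifting along a minimal resolution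
(`KoszulVanishes.ker`) moves H_i(I) to H_0 of the i-th syzygy module, and there H_0 detects every
basis element (`KoszulVanishes.deg_ne`).

For monomial ideals, generators are added one at a time. If J = (u_k : k ∈ T), then J ∩ (u_p) is
generated by the monomials lcm(u_k, u_p), so by Mayer-Vietoris the vanishing of H_i(J + (u_p))
follows from that of H_i(J), H_i((u_p)) and H_{i-1} of this lcm ideal.

(a) `koszulVanishes_of_sup_eq`: if any t generators have the same lcm, so do any t - 1 of the
lcm(u_k, u_p), and t drops together with i until t = 1, where the ideal is principal. The bound n
holds because the Koszul complex has length n.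

(b) `koszulVanishes_of_cover`: let N be the number of variables that occur and w a lower bound for
the size of a cover. Passing to the lcm ideal keeps N and lowers w by one, while j - i grows by one;
dropping u_p lowers w by no more than the number of variables lost. -/

namespace SquarefreeBounds

noncomputable section

/-! ### The Koszul complex on the variables and its exactness over S -/

section Koszul

variable {K : Type*} [Field K] {n : ℕ}

/-- Subsets of a list of variables, indexing the basis of the Koszul complex. -/
inductive KoszulIndex {n : ℕ} : List (Fin n) → Type
  | nil : KoszulIndex []
  | skip {i : Fin n} {l : List (Fin n)} (s : KoszulIndex l) : KoszulIndex (i :: l)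
  | take {i : Fin n} {l : List (Fin n)} (s : KoszulIndex l) : KoszulIndex (i :: l)

namespace KoszulIndex

/-- The number of elements of the subset. -/
def card : {l : List (Fin n)} → KoszulIndex l → ℕ
  | [], _ => 0
  | _ :: _, KoszulIndex.skip s => card s
  | _ :: _, KoszulIndex.take s => card s + 1

/-- The empty subset. -/
def empty : (l : List (Fin n)) → KoszulIndex l
  | [] => nil
  | _ :: l => KoszulIndex.skip (empty l)

theorem card_empty : ∀ l : List (Fin n), (empty l).card = 0
  | [] => rfl
  | _ :: l => card_empty l

theorem card_le_length : ∀ {l : List (Fin n)} (s : KoszulIndex l), s.card ≤ l.length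
  | [], nil => le_rfl
  | _ :: _, KoszulIndex.skip s => (card_le_length s).trans (Nat.le_succ _)
  | _ :: _, KoszulIndex.take s => Nat.succ_le_succ (card_le_length s)

end KoszulIndex

theorem KoszulIndex.funext_cons {α : Type*} {i : Fin n} {l : List (Fin n)}
    {f g : KoszulIndex (i :: l) → α}
    (h₁ : (fun s => f (KoszulIndex.skip s)) = fun s => g (KoszulIndex.skip s))
    (h₂ : (fun s => f (KoszulIndex.take s)) = fun s => g (KoszulIndex.take s)) : f = g := by
  funext s
  cases s with
  | skip s => exact congrFun h₁ s
  | take s => exact congrFun h₂ s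

/-- The function on the subsets of `i :: l` with given values on the subsets without and with
the first element. -/
def KoszulIndex.elim {α : Type*} {i : Fin n} {l : List (Fin n)} (a b : KoszulIndex l → α) :
    KoszulIndex (i :: l) → α
  | .skip s => a s
  | .take s => b s

variable {M M' : Type*} [AddCommGroup M] [Module (MvPolynomial (Fin n) K) M]
  [AddCommGroup M'] [Module (MvPolynomial (Fin n) K) M']

/-- The differential of the Koszul complex on the variables in `l` with coefficients in `M`,
as an iterated mapping cone. -/
def koszulD : (l : List (Fin n)) →
    (KoszulIndex l → M) →ₗ[MvPolynomial (Fin n) K] (KoszulIndex l → M)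
  | [] => 0
  | i :: l =>
    { toFun := fun f => KoszulIndex.elim
        (koszulD l (fun s => f (KoszulIndex.skip s)) + (X i : MvPolynomial (Fin n) K) • fun s => f (KoszulIndex.take s))
        (-koszulD l (fun s => f (KoszulIndex.take s)))
      map_add' := fun f g => by
        have h (e : KoszulIndex l → KoszulIndex (i :: l)) :
            (fun s => (f + g) (e s)) = (fun s => f (e s)) + fun s => g (e s) := rfl
        apply KoszulIndex.funext_cons
        · show koszulD l _ + _ • _ = (koszulD l _ + _ • _) + (koszulD l _ + _ • _)
          rw [h, h, map_add, smul_add, add_add_add_comm]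
        · show -koszulD l _ = -koszulD l _ + -koszulD l _
          rw [h, map_add, neg_add]
      map_smul' := fun r f => by
        have h (e : KoszulIndex l → KoszulIndex (i :: l)) :
            (fun s => (r • f) (e s)) = r • (fun s => f (e s)) := rfl
        apply KoszulIndex.funext_cons
        · show koszulD l _ + _ • _ = r • (koszulD l _ + _ • _)
          rw [h, h, map_smul, smul_comm, smul_add]
        · show -koszulD l _ = r • -koszulD l _
          rw [h, map_smul, smul_neg] }

theorem koszulD_inl (i : Fin n) (l : List (Fin n)) (f : KoszulIndex (i :: l) → M) :
    (fun s => koszulD (K := K) (i :: l) f (KoszulIndex.skip s)) =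
      koszulD (K := K) l (fun s => f (KoszulIndex.skip s)) +
        (X i : MvPolynomial (Fin n) K) • fun s => f (KoszulIndex.take s) := rfl

theorem koszulD_inr (i : Fin n) (l : List (Fin n)) (f : KoszulIndex (i :: l) → M) :
    (fun s => koszulD (K := K) (i :: l) f (KoszulIndex.take s)) =
      -koszulD (K := K) l (fun s => f (KoszulIndex.take s)) := rfl

theorem koszulD_koszulD : ∀ (l : List (Fin n)) (f : KoszulIndex l → M),
    koszulD (K := K) l (koszulD (K := K) l f) = 0
  | [], _ => rfl
  | i :: l, f => by
    apply KoszulIndex.funext_cons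
    · rw [koszulD_inl, koszulD_inl, koszulD_inr, map_add, map_smul, koszulD_koszulD l, zero_add,
        smul_neg, add_neg_cancel]
      rfl
    · rw [koszulD_inr, koszulD_inr, map_neg, koszulD_koszulD l, neg_zero, neg_zero]
      rfl

theorem koszulD_comp (φ : M →ₗ[MvPolynomial (Fin n) K] M') :
    ∀ (l : List (Fin n)) (f : KoszulIndex l → M),
      koszulD (K := K) l (fun s => φ (f s)) = fun s => φ (koszulD (K := K) l f s)
  | [], _ => by funext s; exact (map_zero φ).symm
  | i :: l, f => by
    apply KoszulIndex.funext_cons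
    · rw [koszulD_inl, koszulD_comp φ l]
      funext s
      have := congrFun (koszulD_inl (K := K) i l f) s
      rw [this]
      simp
    · rw [koszulD_inr, koszulD_comp φ l]
      funext s
      have := congrFun (koszulD_inr (K := K) i l f) s
      rw [this]
      simp

theorem koszulD_mem (N : Submodule (MvPolynomial (Fin n) K) M) :
    ∀ (l : List (Fin n)) (f : KoszulIndex l → M), (∀ s, f s ∈ N) →
      ∀ s, koszulD (K := K) l f s ∈ N
  | [], _, _, _ => N.zero_mem
  | _ :: l, _, hf, KoszulIndex.skip s => N.add_mem (koszulD_mem N l _ (fun s => hf (KoszulIndex.skip s)) s)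
      (N.smul_mem _ (hf (KoszulIndex.take s)))
  | _ :: l, _, hf, KoszulIndex.take s => N.neg_mem (koszulD_mem N l _ (fun s => hf (KoszulIndex.take s)) s)

/-- In degree 0 a boundary is the sum of the x_i f({i}). This is the source of all membership
statements in 𝔪N below. -/
theorem koszulD_empty_mem (N : Submodule (MvPolynomial (Fin n) K) M) :
    ∀ (l : List (Fin n)) (f : KoszulIndex l → M), (∀ s, f s ∈ N) →
      koszulD (K := K) l f (KoszulIndex.empty l) ∈
        (Ideal.span (X '' {i | i ∈ l}) : Ideal (MvPolynomial (Fin n) K)) • N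
  | [], _, _ => Submodule.zero_mem _
  | i :: l, f, hf => by
    refine Submodule.add_mem _ (Submodule.smul_mono_left (Ideal.span_mono ?_)
      (koszulD_empty_mem N l _ fun s => hf (KoszulIndex.skip s)))
      (Submodule.smul_mem_smul (Ideal.subset_span ⟨i, List.mem_cons_self, rfl⟩) (hf (KoszulIndex.take _)))
    exact Set.image_mono fun a ha => List.mem_cons_of_mem _ ha

/-- An element of the Koszul complex in homological degree `0` is a cycle. -/
theorem koszulD_eq_zero_of_card : ∀ (l : List (Fin n)) (f : KoszulIndex l → M),
    (∀ s, s.card ≠ 0 → f s = 0) → koszulD (K := K) l f = 0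
  | [], _, _ => rfl
  | i :: l, f, hf => by
    have h0 : (fun s => f (KoszulIndex.take s)) = 0 := funext fun s => hf (KoszulIndex.take s) (Nat.succ_ne_zero _)
    apply KoszulIndex.funext_cons
    · rw [koszulD_inl, h0, smul_zero, koszulD_eq_zero_of_card l _ fun s hs => hf (KoszulIndex.skip s) hs,
        add_zero]
      rfl
    · rw [koszulD_inr, h0, map_zero, neg_zero]
      rfl

open Classical in
/-- The projection of the Koszul complex with coefficients in `M` to homological degree `i` and
internal degree `j`, where `γ` gives the graded components of `M`. -/
def koszulComponent (γ : ℤ → M →+ M) (l : List (Fin n)) (i j : ℤ) (f : KoszulIndex l → M) :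
    KoszulIndex l → M :=
  fun s => if (s.card : ℤ) = i then γ (j - i) (f s) else 0

theorem koszulComponent_inl (γ : ℤ → M →+ M) (a : Fin n) (l : List (Fin n)) (i j : ℤ)
    (f : KoszulIndex (a :: l) → M) :
    (fun s => koszulComponent γ (a :: l) i j f (KoszulIndex.skip s)) =
      koszulComponent γ l i j fun s => f (KoszulIndex.skip s) := rfl

/-- Taking one more variable raises the homological and the internal degree by one each, so the
degree j - i of the coefficient is unchanged. -/
theorem koszulComponent_inr (γ : ℤ → M →+ M) (a : Fin n) (l : List (Fin n)) (i j : ℤ)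
    (f : KoszulIndex (a :: l) → M) :
    (fun s => koszulComponent γ (a :: l) i j f (KoszulIndex.take s)) =
      koszulComponent γ l (i - 1) (j - 1) fun s => f (KoszulIndex.take s) := by
  funext s
  have h : ((KoszulIndex.card (l := a :: l) (KoszulIndex.take s) : ℕ) : ℤ) = i ↔ (s.card : ℤ) = i - 1 := by
    show ((s.card + 1 : ℕ) : ℤ) = i ↔ _
    push_cast
    omega
  simp only [koszulComponent, h, sub_sub_sub_cancel_right]

theorem koszulComponent_add (γ : ℤ → M →+ M) (l : List (Fin n)) (i j : ℤ)
    (f g : KoszulIndex l → M) : koszulComponent γ l i j (f + g) =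
      koszulComponent γ l i j f + koszulComponent γ l i j g := by
  funext s
  simp only [koszulComponent, Pi.add_apply, map_add]
  split_ifs <;> simp

theorem koszulComponent_neg (γ : ℤ → M →+ M) (l : List (Fin n)) (i j : ℤ)
    (f : KoszulIndex l → M) : koszulComponent γ l i j (-f) = -koszulComponent γ l i j f := by
  funext s
  simp only [koszulComponent, Pi.neg_apply, map_neg]
  split_ifs <;> simp

/-- The differential removes one variable from the index and multiplies the coefficient by it, hence
preserves the internal degree. -/
theorem koszulD_koszulComponent (γ : ℤ → M →+ M)
    (hγ : ∀ j a m, γ j ((X a : MvPolynomial (Fin n) K) • m) =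
      (X a : MvPolynomial (Fin n) K) • γ (j - 1) m) :
    ∀ (l : List (Fin n)) (i j : ℤ) (f : KoszulIndex l → M),
      koszulD (K := K) l (koszulComponent γ l i j f) =
        koszulComponent γ l (i - 1) j (koszulD (K := K) l f)
  | [], _, _, _ => by
    funext s
    simp [koszulComponent, koszulD]
  | a :: l, i, j, f => by
    apply KoszulIndex.funext_cons
    · rw [koszulD_inl, koszulComponent_inl, koszulComponent_inl, koszulD_inl, koszulComponent_inr,
        koszulD_koszulComponent γ hγ l, koszulComponent_add]
      congr 1
      funext s
      simp only [koszulComponent, Pi.smul_apply, smul_ite, smul_zero, hγ]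
      rw [show j - 1 - (i - 1) = j - i by ring, show j - (i - 1) - 1 = j - i by ring]
    · rw [koszulD_inr, koszulComponent_inr, koszulComponent_inr, koszulD_inr,
        koszulD_koszulComponent γ hγ l, koszulComponent_neg]

theorem koszulComponent_self (γ : ℤ → M →+ M) (hγ : ∀ j m, γ j (γ j m) = γ j m)
    (l : List (Fin n)) (i j : ℤ) (f : KoszulIndex l → M) :
    koszulComponent γ l i j (koszulComponent γ l i j f) = koszulComponent γ l i j f := by
  funext s
  simp only [koszulComponent]
  split_ifs <;> simp [hγ]

theorem X_mul_mem_span_image {l : Set (Fin n)} {i : Fin n} (hi : i ∉ l) {p : MvPolynomial (Fin n) K}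
    (h : X i * p ∈ (Ideal.span (X '' l) : Ideal (MvPolynomial (Fin n) K))) :
    p ∈ (Ideal.span (X '' l) : Ideal (MvPolynomial (Fin n) K)) := by
  rw [mem_ideal_span_X_image] at h ⊢
  intro m hm
  obtain ⟨k, hk, hmk⟩ := h (m + Finsupp.single i 1) (by
    rw [mem_support_iff, mul_comm, coeff_mul_X]
    exact mem_support_iff.mp hm)
  refine ⟨k, hk, ?_⟩
  have : i ≠ k := fun h => hi (h ▸ hk)
  simpa [Finsupp.single_apply, this] using hmk

/-- The Koszul complex of the polynomial ring is exact in positive degrees, and its homology in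
degree `0` is the quotient by the variables. -/
theorem koszul_exact : ∀ (l : List (Fin n)) (_ : l.Nodup)
    (f : KoszulIndex l → MvPolynomial (Fin n) K), koszulD (K := K) l f = 0 →
    f (KoszulIndex.empty l) ∈ (Ideal.span (X '' {i | i ∈ l}) : Ideal (MvPolynomial (Fin n) K)) →
    ∃ g : KoszulIndex l → MvPolynomial (Fin n) K, koszulD (K := K) l g = f
  | [], _, f, _, hf => by
    refine ⟨0, ?_⟩
    funext s
    have : f (KoszulIndex.empty []) = 0 := by simpa using hf
    cases s
    exact this.symm
  | i :: l, hl, f, hd, hf => by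
    classical
    rw [List.nodup_cons] at hl
    have h1 := koszulD_inl (K := K) i l f
    have h2 := koszulD_inr (K := K) i l f
    rw [hd] at h1 h2
    set a : KoszulIndex l → MvPolynomial (Fin n) K := fun s => f (KoszulIndex.skip s) with ha
    set b : KoszulIndex l → MvPolynomial (Fin n) K := fun s => f (KoszulIndex.take s) with hb
    have hdb : koszulD (K := K) l b = 0 := neg_eq_zero.mp h2.symm
    have hda : koszulD (K := K) l a + (X i : MvPolynomial (Fin n) K) • b = 0 := h1.symm
    -- In degree 0, x_i b = -d a lies in the ideal (l), and x_i is a nonzerodivisor modulo (l).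
    have hbm : b (KoszulIndex.empty l) ∈
        (Ideal.span (X '' {i | i ∈ l}) : Ideal (MvPolynomial (Fin n) K)) := by
      apply X_mul_mem_span_image (i := i) hl.1
      have h3 := congrFun hda (KoszulIndex.empty l)
      have h4 := koszulD_empty_mem (K := K) (⊤ : Submodule _ (MvPolynomial (Fin n) K)) l a (by simp)
      simp only [Pi.add_apply, Pi.smul_apply, smul_eq_mul, Pi.zero_apply] at h3
      rw [eq_neg_of_add_eq_zero_right h3]
      refine neg_mem ?_
      simpa using h4
    obtain ⟨b', hb'⟩ := koszul_exact l hl.2 b hdb hbm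
    have haf : a (KoszulIndex.empty l) ∈ (Ideal.span (insert (X i) (X '' {i | i ∈ l})) :
        Ideal (MvPolynomial (Fin n) K)) := by
      have : (X '' {k | k ∈ i :: l} : Set (MvPolynomial (Fin n) K)) =
          insert (X i) (X '' {i | i ∈ l}) := by
        rw [← Set.image_insert_eq]
        congr 1
        ext k
        simp
      rw [← this]
      exact hf
    obtain ⟨r, c, hc, hac⟩ := Ideal.mem_span_insert.mp haf
    -- The chain a + x_i b' is a cycle, but its degree 0 term need not lie in (l). Subtracting the
    -- degree 0 cycle z from b' turns this term into c ∈ (l), where a(∅) = r x_i + c.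
    let z : KoszulIndex l → MvPolynomial (Fin n) K := fun s =>
      if s.card = 0 then b' (KoszulIndex.empty l) + r else 0
    have hz : koszulD (K := K) l z = 0 := koszulD_eq_zero_of_card l z fun s hs => if_neg hs
    have hcyc : koszulD (K := K) l (a + (X i : MvPolynomial (Fin n) K) • (b' - z)) = 0 := by
      rw [map_add, map_smul, map_sub, hz, sub_zero, hb', hda]
    obtain ⟨a', ha'⟩ := koszul_exact l hl.2 _ hcyc (by
      have : (a + (X i : MvPolynomial (Fin n) K) • (b' - z)) (KoszulIndex.empty l) = c := by
        simp only [Pi.add_apply, Pi.smul_apply, Pi.sub_apply, z, KoszulIndex.card_empty, if_true,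
          smul_eq_mul, hac]
        ring
      rw [this]
      exact hc)
    refine ⟨KoszulIndex.elim a' (-(b' - z)), KoszulIndex.funext_cons ?_ ?_⟩
    · rw [koszulD_inl]
      show koszulD l a' + (X i : MvPolynomial (Fin n) K) • (-(b' - z)) = a
      rw [ha', smul_neg, add_neg_cancel_right]
    · rw [koszulD_inr]
      show -koszulD l (-(b' - z)) = b
      rw [map_neg, neg_neg, map_sub, hz, sub_zero, hb']

theorem idealOfVars_eq_span_finRange :
    idealOfVars (Fin n) K = Ideal.span (X '' {i | i ∈ List.finRange n}) := by
  rw [idealOfVars]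
  simp [Set.image_univ]

theorem koszul_exact_pi {r : ℕ} (f : KoszulIndex (List.finRange n) → Fin r → MvPolynomial (Fin n) K)
    (hd : koszulD (K := K) _ f = 0)
    (hf : ∀ a, f (KoszulIndex.empty _) a ∈ idealOfVars (Fin n) K) :
    ∃ g : KoszulIndex (List.finRange n) → Fin r → MvPolynomial (Fin n) K,
      koszulD (K := K) _ g = f := by
  have h : ∀ a : Fin r, ∃ g : KoszulIndex (List.finRange n) → MvPolynomial (Fin n) K,
      koszulD (K := K) _ g = fun s => f s a := by
    intro a
    apply koszul_exact _ (List.nodup_finRange n)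
    · have := koszulD_comp (LinearMap.proj a : (Fin r → MvPolynomial (Fin n) K) →ₗ[MvPolynomial (Fin n) K] _) _ f
      simp only [LinearMap.proj_apply] at this
      rw [this, hd]
      rfl
    · rw [← idealOfVars_eq_span_finRange]
      exact hf a
  choose g hg using h
  refine ⟨fun s a => g a s, ?_⟩
  funext s a
  have := koszulD_comp (K := K)
    (LinearMap.proj a : (Fin r → MvPolynomial (Fin n) K) →ₗ[MvPolynomial (Fin n) K] _) _
    (fun s a => g a s)
  simp only [LinearMap.proj_apply] at this
  rw [← congrFun this s]
  exact congrFun (hg a) s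

end Koszul

/-! ### Vanishing of Koszul homology and of Betti numbers -/

section Vanishing

variable {K : Type*} [Field K] {n : ℕ}

/-- Every Koszul cycle with coefficients in `N` has a boundary as its component in homological
degree `i` and internal degree `j`, i.e. `Tor_i(N, K)_j = 0`. -/
def KoszulVanishes {M : Type*} [AddCommGroup M] [Module (MvPolynomial (Fin n) K) M]
    (γ : ℤ → M →+ M) (N : Submodule (MvPolynomial (Fin n) K) M) (i j : ℤ) : Prop :=
  ∀ f : KoszulIndex (List.finRange n) → M, (∀ s, f s ∈ N) → koszulD (K := K) _ f = 0 →
    ∃ g : KoszulIndex (List.finRange n) → M, (∀ s, g s ∈ N) ∧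
      koszulD (K := K) _ g = koszulComponent γ _ i j f

/-- The graded components of the graded free module `⨁ₐ S(-deg a)`. -/
def vecGrading {r : ℕ} (deg : Fin r → ℕ) (j : ℤ) :
    (Fin r → MvPolynomial (Fin n) K) →+ (Fin r → MvPolynomial (Fin n) K) where
  toFun v := if 0 ≤ j then vecComponent deg j.toNat v else 0
  map_zero' := by
    funext a
    split_ifs
    · ext m
      rw [coeff_vecComponent]
      simp
    · rfl
  map_add' v w := by
    funext a
    split_ifs
    · ext m
      simp only [Pi.add_apply, coeff_add, coeff_vecComponent]
      split_ifs <;> simp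
    · simp

theorem coeff_vecGrading {r : ℕ} (deg : Fin r → ℕ) (j : ℤ) (v : Fin r → MvPolynomial (Fin n) K)
    (a : Fin r) (m : Fin n →₀ ℕ) : coeff m (vecGrading deg j v a) =
      if (m.degree : ℤ) + deg a = j then coeff m (v a) else 0 := by
  show coeff m ((if 0 ≤ j then vecComponent deg j.toNat v else 0 : Fin r → _) a) = _
  split_ifs with h1 h2 h2
  · rw [coeff_vecComponent, if_pos (by omega)]
  · rw [coeff_vecComponent, if_neg (by omega)]
  · omega
  · simp

theorem map_vecGrading {r r' : ℕ} (deg : Fin r → ℕ) (deg' : Fin r' → ℕ)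
    (φ : (Fin r' → MvPolynomial (Fin n) K) →ₗ[MvPolynomial (Fin n) K]
      (Fin r → MvPolynomial (Fin n) K))
    (hφ : ∀ b, IsHomogeneousVec deg (deg' b) (φ (Pi.single b 1))) (j : ℤ)
    (v : Fin r' → MvPolynomial (Fin n) K) :
    φ (vecGrading deg' j v) = vecGrading deg j (φ v) := by
  show φ (if 0 ≤ j then vecComponent deg' j.toNat v else 0) =
    if 0 ≤ j then vecComponent deg j.toNat (φ v) else 0
  split_ifs
  · exact map_vecComponent deg deg' φ hφ _ v
  · exact map_zero φ

/-- The graded components of the polynomial ring. -/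
def polyGrading (j : ℤ) : MvPolynomial (Fin n) K →+ MvPolynomial (Fin n) K where
  toFun p := vecGrading (fun _ : Fin 1 => 0) j (fun _ => p) 0
  map_zero' := congrFun (map_zero (vecGrading (fun _ : Fin 1 => 0) j)) 0
  map_add' p q := congrFun (map_add (vecGrading (fun _ : Fin 1 => 0) j) (fun _ => p) fun _ => q) 0

theorem coeff_polyGrading (j : ℤ) (p : MvPolynomial (Fin n) K) (m : Fin n →₀ ℕ) :
    coeff m (polyGrading j p) = if (m.degree : ℤ) = j then coeff m p else 0 := by
  show coeff m (vecGrading (fun _ : Fin 1 => 0) j (fun _ => p) 0) = _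
  rw [coeff_vecGrading]
  simp

theorem polyGrading_polyGrading (j : ℤ) (p : MvPolynomial (Fin n) K) :
    polyGrading j (polyGrading j p) = polyGrading j p := by
  ext m
  simp only [coeff_polyGrading]
  split_ifs <;> rfl

theorem polyGrading_monomial_mul (j : ℤ) (v : Fin n →₀ ℕ) (p : MvPolynomial (Fin n) K) :
    polyGrading j (monomial v 1 * p) = monomial v 1 * polyGrading (j - v.degree) p := by
  ext m
  simp only [coeff_polyGrading, coeff_monomial_mul', one_mul]
  by_cases h : v ≤ m
  · have h1 : m.degree = (m - v).degree + v.degree := by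
      rw [← map_add, tsub_add_cancel_of_le h]
    have h2 : (m.degree : ℤ) = j ↔ ((m - v).degree : ℤ) = j - v.degree := by omega
    simp only [h, if_true, h2]
  · simp [h]

theorem polyGrading_X_smul (j : ℤ) (a : Fin n) (p : MvPolynomial (Fin n) K) :
    polyGrading j ((X a : MvPolynomial (Fin n) K) • p) =
      (X a : MvPolynomial (Fin n) K) • polyGrading (j - 1) p := by
  simp only [smul_eq_mul]
  rw [X, polyGrading_monomial_mul]
  simp

theorem vecGrading_X_smul {r : ℕ} (deg : Fin r → ℕ) (j : ℤ) (a : Fin n)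
    (v : Fin r → MvPolynomial (Fin n) K) :
    vecGrading deg j ((X a : MvPolynomial (Fin n) K) • v) =
      (X a : MvPolynomial (Fin n) K) • vecGrading deg (j - 1) v := by
  have h (j : ℤ) (v : Fin r → MvPolynomial (Fin n) K) (b : Fin r) :
      vecGrading deg j v b = polyGrading (j - deg b) (v b) := by
    ext m
    rw [coeff_vecGrading, coeff_polyGrading]
    simp only [eq_sub_iff_add_eq]
  funext b
  rw [Pi.smul_apply, h, h, Pi.smul_apply, polyGrading_X_smul, sub_right_comm]

/-- S is the free module of rank one with its generator in degree 0. -/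
theorem map_polyGrading {r : ℕ} (deg : Fin r → ℕ)
    (φ : (Fin r → MvPolynomial (Fin n) K) →ₗ[MvPolynomial (Fin n) K] MvPolynomial (Fin n) K)
    (hφ : ∀ b, (φ (Pi.single b 1)).IsHomogeneous (deg b)) (j : ℤ)
    (v : Fin r → MvPolynomial (Fin n) K) :
    φ (vecGrading deg j v) = polyGrading j (φ v) := by
  refine congrFun (map_vecGrading (fun _ : Fin 1 => 0) deg (LinearMap.pi fun _ => φ) ?_ j v) 0
  intro b a m hm
  have := hφ b (mem_support_iff.mp hm)
  rw [show (1 : Fin n → ℕ) = fun _ => 1 from rfl, ← Finsupp.degree_eq_weight_one] at this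
  simpa using this

section DimensionShift

variable {M : Type*} [AddCommGroup M] [Module (MvPolynomial (Fin n) K) M]

/-- Dimension shifting: the homology of a syzygy module of `range φ`. -/
theorem KoszulVanishes.ker {γ : ℤ → M →+ M} {r : ℕ} {deg : Fin r → ℕ}
    {φ : (Fin r → MvPolynomial (Fin n) K) →ₗ[MvPolynomial (Fin n) K] M}
    (hφ : ∀ j v, φ (vecGrading deg j v) = γ j (φ v))
    (hker : ∀ v ∈ LinearMap.ker φ, ∀ a, v a ∈ idealOfVars (Fin n) K) {i j : ℤ}
    (h : KoszulVanishes γ (LinearMap.range φ) (i + 1) j) :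
    KoszulVanishes (vecGrading deg) (LinearMap.ker φ) i j := by
  intro f hf hdf
  have hm : ∀ a, f (KoszulIndex.empty _) a ∈ idealOfVars (Fin n) K := hker _ (hf _)
  have hφf : (fun s => φ (f s)) = 0 := funext fun s => LinearMap.mem_ker.mp (hf s)
  -- This is the connecting map H_{i+1}(range φ) → H_i(ker φ) read backwards: f bounds some g in the
  -- free module, and φ(g) is a cycle in range φ. For i = 0 the inclusion ker φ ⊆ 𝔪F is what makes f
  -- a boundary.
  obtain ⟨g, hg⟩ := koszul_exact_pi f hdf hm
  have hdg : koszulD (K := K) _ (fun s => φ (g s)) = 0 := by rw [koszulD_comp, hg, hφf]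
  obtain ⟨e, he, hde⟩ := h (fun s => φ (g s)) (fun s => LinearMap.mem_range_self φ (g s)) hdg
  choose e' he' using he
  refine ⟨koszulComponent (vecGrading deg) _ (i + 1) j g - koszulD (K := K) _ e', ?_, ?_⟩
  · intro s
    have h1 := congrFun (koszulD_comp φ (List.finRange n) e') s
    simp only [he'] at h1
    rw [hde] at h1
    rw [LinearMap.mem_ker, Pi.sub_apply, map_sub, ← h1]
    simp only [koszulComponent]
    split_ifs <;> simp [hφ]
  · have hX : ∀ (j : ℤ) (a : Fin n) (v : Fin r → MvPolynomial (Fin n) K),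
        vecGrading deg j ((X a : MvPolynomial (Fin n) K) • v) =
          (X a : MvPolynomial (Fin n) K) • vecGrading deg (j - 1) v := vecGrading_X_smul deg
    have h2 : koszulD (K := K) _ (koszulComponent (vecGrading deg) _ (i + 1) j g) =
      koszulComponent (vecGrading deg) _ (i + 1 - 1) j (koszulD (K := K) _ g) :=
        koszulD_koszulComponent _ hX _ _ _ _
    rw [hg, add_sub_cancel_right] at h2
    rw [map_sub, koszulD_koszulD, sub_zero, h2]

theorem KoszulVanishes.deg_ne {γ : ℤ → M →+ M} {r : ℕ} {deg : Fin r → ℕ}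
    {φ : (Fin r → MvPolynomial (Fin n) K) →ₗ[MvPolynomial (Fin n) K] M}
    (hφ : ∀ j v, φ (vecGrading deg j v) = γ j (φ v))
    (hker : ∀ v ∈ LinearMap.ker φ, ∀ a, v a ∈ idealOfVars (Fin n) K) {j : ℕ}
    (h : KoszulVanishes γ (LinearMap.range φ) 0 j) (a : Fin r) : deg a ≠ j := by
  classical
  intro ha
  have hcard : (KoszulIndex.empty (List.finRange n)).card = 0 := KoszulIndex.card_empty _
  -- If deg a = j, vanishing of H_0 in degree j puts φ(e_a) into 𝔪 · range φ, so φ(e_a) = φ(w) with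
  -- w ∈ 𝔪F. Then e_a - w ∈ ker φ ⊆ 𝔪F, which forces 1 ∈ 𝔪.
  let f : KoszulIndex (List.finRange n) → M := fun s => if s.card = 0 then φ (Pi.single a 1) else 0
  obtain ⟨g, hg, hdg⟩ := h f (fun s => by
      simp only [f]
      split_ifs
      · exact ⟨_, rfl⟩
      · exact Submodule.zero_mem _) (koszulD_eq_zero_of_card _ _ fun s hs => if_neg hs)
  have h1 := koszulD_empty_mem (K := K) (LinearMap.range φ) _ g hg
  have h2 : vecGrading deg (j : ℤ) (Pi.single a 1 : Fin r → MvPolynomial (Fin n) K) =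
      Pi.single a 1 := by
    funext b
    ext m
    rw [coeff_vecGrading]
    by_cases hb : b = a
    · subst hb
      rw [Pi.single_eq_same, coeff_one]
      by_cases hm : 0 = m
      · subst hm
        simp [ha]
      · simp [hm]
    · simp [hb]
  rw [hdg, ← idealOfVars_eq_span_finRange] at h1
  simp only [koszulComponent, hcard, f, Nat.cast_zero, if_true, sub_zero] at h1
  rw [← hφ, h2, ← Submodule.map_top, ← Submodule.map_smul''] at h1
  obtain ⟨w, hw, hwφ⟩ := h1
  have hwm : ∀ b, w b ∈ idealOfVars (Fin n) K := by
    intro b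
    clear hwφ
    induction hw using Submodule.smul_induction_on' with
    | smul c hc v _ => exact Ideal.mul_mem_right _ _ hc
    | add v _ v' _ hv hv' => exact add_mem hv hv'
  have hone : (1 : MvPolynomial (Fin n) K) ∈ idealOfVars (Fin n) K := by
    have h3 := hker (Pi.single a 1 - w) (by rw [LinearMap.mem_ker, map_sub, hwφ, sub_self]) a
    have := add_mem h3 (hwm a)
    simpa using this
  rw [idealOfVars, ← Set.image_univ, mem_ideal_span_X_image] at hone
  obtain ⟨i, -, hi⟩ := hone 0 (by simp)
  exact hi rfl

end DimensionShift

/-- Each of the p + 1 syzygy steps from I to range d_p costs one homological degree. -/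
theorem GradedFreeResolution.IsMinimal.koszulVanishes_range
    {I : Ideal (MvPolynomial (Fin n) K)} {F : GradedFreeResolution I} (hF : F.IsMinimal) {j : ℤ} :
    ∀ (p : ℕ) (i : ℤ), KoszulVanishes polyGrading I (i + p + 1) j →
      KoszulVanishes (vecGrading (F.deg p)) (LinearMap.range (F.d p)) i j
  | 0, i, h => by
    rw [F.exact_zero]
    refine KoszulVanishes.ker (γ := polyGrading) (map_polyGrading _ F.ε F.ε_homogeneous) ?_ ?_
    · rw [← F.exact_zero]
      rintro _ ⟨v, rfl⟩ a
      exact hF 0 v a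
    · rw [F.range_ε]
      simpa using h
  | p + 1, i, h => by
    rw [F.exact_succ]
    refine KoszulVanishes.ker (map_vecGrading _ _ (F.d p) (F.d_homogeneous p)) ?_
      (koszulVanishes_range hF p (i + 1) ?_)
    · rw [← F.exact_succ]
      rintro _ ⟨v, rfl⟩ a
      exact hF (p + 1) v a
    · convert h using 1
      push_cast
      ring

theorem GradedFreeResolution.IsMinimal.betti_eq_zero
    {I : Ideal (MvPolynomial (Fin n) K)} {F : GradedFreeResolution I} (hF : F.IsMinimal) {i j : ℕ}
    (h : KoszulVanishes polyGrading I i j) : F.betti i j = 0 := by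
  rw [betti, Finset.card_eq_zero, Finset.filter_eq_empty_iff]
  intro a _
  cases i with
  | zero =>
    refine KoszulVanishes.deg_ne (map_polyGrading _ F.ε F.ε_homogeneous) ?_ ?_ a
    · rw [← F.exact_zero]
      rintro _ ⟨v, rfl⟩ a
      exact hF 0 v a
    · rw [F.range_ε]
      exact h
  | succ p =>
    refine KoszulVanishes.deg_ne (map_vecGrading _ _ (F.d p) (F.d_homogeneous p)) ?_
      (hF.koszulVanishes_range p 0 ?_) a
    · rw [← F.exact_succ]
      rintro _ ⟨v, rfl⟩ a
      exact hF (p + 1) v a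
    · convert h using 1
      push_cast
      ring

/-- No subset of the n variables has more than n elements. -/
theorem koszulVanishes_of_length_lt {M : Type*} [AddCommGroup M]
    [Module (MvPolynomial (Fin n) K) M] (γ : ℤ → M →+ M)
    (N : Submodule (MvPolynomial (Fin n) K) M) {i : ℤ} (hi : n < i) (j : ℤ) :
    KoszulVanishes γ N i j := by
  intro f _ _
  refine ⟨0, fun _ => N.zero_mem, ?_⟩
  rw [map_zero]
  funext s
  have h := s.card_le_length
  rw [List.length_finRange] at h
  exact (if_neg (by omega)).symm

theorem koszulComponent_mem {M : Type*} [AddCommGroup M] [Module (MvPolynomial (Fin n) K) M]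
    {γ : ℤ → M →+ M} {N : Submodule (MvPolynomial (Fin n) K) M} (hN : ∀ j, ∀ v ∈ N, γ j v ∈ N)
    (l : List (Fin n)) (i j : ℤ) {f : KoszulIndex l → M} (hf : ∀ s, f s ∈ N) (s : KoszulIndex l) :
    koszulComponent γ l i j f s ∈ N := by
  simp only [koszulComponent]
  split_ifs
  · exact hN _ _ (hf s)
  · exact N.zero_mem

/-- The Mayer-Vietoris sequence of a sum of two graded submodules. -/
theorem KoszulVanishes.sup {M : Type*} [AddCommGroup M] [Module (MvPolynomial (Fin n) K) M]
    {γ : ℤ → M →+ M} (hγ : ∀ j a m, γ j ((X a : MvPolynomial (Fin n) K) • m) =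
      (X a : MvPolynomial (Fin n) K) • γ (j - 1) m) (hγγ : ∀ j m, γ j (γ j m) = γ j m)
    {N₁ N₂ : Submodule (MvPolynomial (Fin n) K) M} (hN₁ : ∀ j, ∀ v ∈ N₁, γ j v ∈ N₁)
    (hN₂ : ∀ j, ∀ v ∈ N₂, γ j v ∈ N₂) {i j : ℤ} (h₁ : KoszulVanishes γ N₁ i j)
    (h₂ : KoszulVanishes γ N₂ i j) (h : KoszulVanishes γ (N₁ ⊓ N₂) (i - 1) j) :
    KoszulVanishes γ (N₁ ⊔ N₂) i j := by
  intro f hf hdf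
  choose f₁ hf₁ f₂ hf₂ hff using fun s => Submodule.mem_sup.mp (hf s)
  have hsum : f₁ + f₂ = f := funext hff
  have hd : koszulD (K := K) _ f₁ = -koszulD (K := K) _ f₂ := by
    rw [← add_eq_zero_iff_eq_neg, ← map_add, hsum, hdf]
  -- d f₁ = -d f₂ is a cycle in N₁ ∩ N₂. Once its (i - 1, j) component is d y, correcting by y makes
  -- the (i, j) components of f₁ and f₂ into cycles.
  obtain ⟨y, hy, hdy⟩ := h (koszulD (K := K) _ f₁) (fun s => ⟨koszulD_mem N₁ _ f₁ hf₁ s, by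
    rw [hd]
    exact N₂.neg_mem (koszulD_mem N₂ _ f₂ hf₂ s)⟩) (koszulD_koszulD _ _)
  obtain ⟨g₁, hg₁, hdg₁⟩ := h₁ (koszulComponent γ _ i j f₁ - y)
    (fun s => N₁.sub_mem (koszulComponent_mem hN₁ _ _ _ hf₁ s) (hy s).1)
    (by rw [map_sub, koszulD_koszulComponent γ hγ, hdy, sub_self])
  obtain ⟨g₂, hg₂, hdg₂⟩ := h₂ (koszulComponent γ _ i j f₂ + y)
    (fun s => N₂.add_mem (koszulComponent_mem hN₂ _ _ _ hf₂ s) (hy s).2)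
    (by rw [map_add, koszulD_koszulComponent γ hγ, hdy, hd, koszulComponent_neg, add_neg_cancel])
  refine ⟨g₁ + g₂, fun s => Submodule.add_mem_sup (hg₁ s) (hg₂ s), ?_⟩
  rw [map_add, hdg₁, hdg₂, ← koszulComponent_add, ← hsum]
  -- y need not be homogeneous, but it cancels in the sum; idempotence of the projection does the
  -- rest.
  rw [show koszulComponent γ _ i j f₁ - y + (koszulComponent γ _ i j f₂ + y) =
    koszulComponent γ _ i j (f₁ + f₂) by rw [koszulComponent_add]; abel]
  exact koszulComponent_self γ hγγ _ _ _ _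

/-- A principal ideal is free on one generator, so its homology is K placed in degree (0, deg v). -/
theorem koszulVanishes_span_monomial (v : Fin n →₀ ℕ) {i j : ℤ} (h : i ≠ 0 ∨ j ≠ v.degree) :
    KoszulVanishes polyGrading (Ideal.span {monomial v (1 : K)}) i j := by
  intro f hf hdf
  choose f' hf' using fun s => Ideal.mem_span_singleton.mp (hf s)
  have hv : (monomial v (1 : K)) ≠ 0 := by simp
  have hff : f = monomial v (1 : K) • f' := funext hf'
  have hdf' : koszulD (K := K) _ f' = 0 := by
    rw [hff, map_smul] at hdf
    exact (smul_eq_zero.mp hdf).resolve_left hv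
  obtain ⟨g, hg⟩ := koszul_exact _ (List.nodup_finRange n)
    (koszulComponent polyGrading _ i (j - v.degree) f') (by
      rw [koszulD_koszulComponent _ polyGrading_X_smul, hdf']
      funext s
      simp [koszulComponent]) (by
    simp only [koszulComponent]
    split_ifs with hc
    · rw [KoszulIndex.card_empty, Nat.cast_zero] at hc
      rw [mem_ideal_span_X_image]
      intro m hm
      rw [mem_support_iff, coeff_polyGrading] at hm
      have hm' : (m.degree : ℤ) = j - v.degree - i := by
        by_contra hne
        exact hm (if_neg hne)
      have hm0 : m ≠ 0 := by
        rintro rfl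
        rcases h with h | h
        · exact h hc.symm
        · rw [map_zero] at hm'
          push_cast at hm'
          omega
      obtain ⟨a, ha⟩ := Finsupp.ne_iff.mp hm0
      exact ⟨a, List.mem_finRange a, ha⟩
    · exact Submodule.zero_mem _)
  refine ⟨monomial v (1 : K) • g, fun s => Ideal.mul_mem_right _ _ (Ideal.subset_span rfl), ?_⟩
  rw [map_smul, hg, hff]
  funext s
  simp only [koszulComponent, Pi.smul_apply, smul_eq_mul, polyGrading_monomial_mul, mul_ite,
    mul_zero]
  rw [sub_right_comm]

end Vanishing

/-! ### Homology of monomial ideals, one generator at a time -/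

section MonomialIdeals

variable {K : Type*} [Field K] {n : ℕ} {ι : Type*}

/-- The ideal generated by the monomials with exponents `u k`, `k ∈ T`. -/
def monomialIdeal (K : Type*) [Field K] {n : ℕ} {ι : Type*} (u : ι → Fin n →₀ ℕ) (T : Finset ι) :
    Ideal (MvPolynomial (Fin n) K) :=
  Ideal.span ((fun v => monomial v (1 : K)) '' (u '' T))

theorem mem_monomialIdeal {u : ι → Fin n →₀ ℕ} {T : Finset ι} {p : MvPolynomial (Fin n) K} :
    p ∈ monomialIdeal K u T ↔ ∀ m ∈ p.support, ∃ k ∈ T, u k ≤ m := by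
  rw [monomialIdeal, mem_ideal_span_monomial_image]
  simp

theorem polyGrading_mem_monomialIdeal (u : ι → Fin n →₀ ℕ) (T : Finset ι) (j : ℤ) :
    ∀ p ∈ monomialIdeal K u T, polyGrading j p ∈ monomialIdeal K u T := by
  intro p hp
  rw [mem_monomialIdeal] at hp ⊢
  intro m hm
  apply hp
  rw [mem_support_iff, coeff_polyGrading] at hm
  rw [mem_support_iff]
  exact fun h => hm (by rw [h, ite_self])

theorem monomialIdeal_empty (u : ι → Fin n →₀ ℕ) : monomialIdeal K u ∅ = ⊥ := by
  simp [monomialIdeal]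

theorem monomialIdeal_singleton (u : ι → Fin n →₀ ℕ) (p : ι) :
    monomialIdeal K u {p} = Ideal.span {monomial (u p) (1 : K)} := by
  simp [monomialIdeal]

theorem monomialIdeal_cons (u : ι → Fin n →₀ ℕ) {p : ι} {T : Finset ι} (hp : p ∉ T) :
    monomialIdeal K u (T.cons p hp) = monomialIdeal K u T ⊔ monomialIdeal K u {p} := by
  rw [monomialIdeal, monomialIdeal, monomialIdeal, ← Ideal.span_union, ← Set.image_union,
    ← Set.image_union, Finset.coe_cons, Finset.coe_singleton, Set.union_singleton]

/-- The family stays indexed by T, so coinciding or redundant lcms do not disturb the later counts.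
-/
theorem monomialIdeal_inf_singleton (u : ι → Fin n →₀ ℕ) (p : ι) (T : Finset ι) :
    monomialIdeal K u T ⊓ monomialIdeal K u {p} = monomialIdeal K (fun k => u k ⊔ u p) T := by
  ext f
  rw [Submodule.mem_inf, mem_monomialIdeal, mem_monomialIdeal, mem_monomialIdeal, ← forall₂_and]
  refine forall₂_congr fun m _ => ?_
  simp only [Finset.mem_singleton, exists_eq_left, sup_le_iff]
  tauto

theorem koszulVanishes_bot {M : Type*} [AddCommGroup M] [Module (MvPolynomial (Fin n) K) M]
    (γ : ℤ → M →+ M) (i j : ℤ) :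
    KoszulVanishes γ (⊥ : Submodule (MvPolynomial (Fin n) K) M) i j := by
  intro f hf _
  have : f = 0 := funext fun s => (Submodule.mem_bot _).mp (hf s)
  refine ⟨0, fun _ => Submodule.zero_mem _, ?_⟩
  rw [map_zero, this]
  funext s
  simp [koszulComponent]

/-- The homology of a monomial ideal is controlled by adding one generator at a time. -/
theorem koszulVanishes_monomialIdeal_cons (u : ι → Fin n →₀ ℕ) {p : ι} {T : Finset ι} (hp : p ∉ T)
    {i j : ℤ} (h : KoszulVanishes polyGrading (monomialIdeal K u T) i j)
    (hpr : i ≠ 0 ∨ j ≠ (u p).degree)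
    (hinf : KoszulVanishes polyGrading (monomialIdeal K (fun k => u k ⊔ u p) T) (i - 1) j) :
    KoszulVanishes polyGrading (monomialIdeal K u (T.cons p hp)) i j := by
  rw [monomialIdeal_cons]
  refine KoszulVanishes.sup polyGrading_X_smul polyGrading_polyGrading
    (polyGrading_mem_monomialIdeal u T) (polyGrading_mem_monomialIdeal u {p}) h ?_ ?_
  · rw [monomialIdeal_singleton]
    exact koszulVanishes_span_monomial _ hpr
  · rwa [monomialIdeal_inf_singleton]

/-- Over the empty set the left side would be ⊥, which is why the inductions below keep to t ≥ 1 and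
to nonempty covers. -/
theorem finset_sup_sup_const {α : Type*} [SemilatticeSup α] [OrderBot α] {R : Finset ι}
    (hR : R.Nonempty) (f : ι → α) (a : α) : (R.sup fun k => f k ⊔ a) = a ⊔ R.sup f := by
  rw [sup_comm, ← Finset.sup_const hR a, ← Finset.sup_sup]
  simp only [Finset.sup_const hR]
  rfl

/-- If any `t ≥ 1` of the monomials have the same least common multiple, the homology vanishes in
degrees `≥ t`. -/
theorem koszulVanishes_of_sup_eq (v : Fin n →₀ ℕ) (T : Finset ι) :
    ∀ (t : ℕ) (_ : 1 ≤ t) (u : ι → Fin n →₀ ℕ) (_ : ∀ R ⊆ T, R.card = t → R.sup u = v) (i j : ℤ)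
      (_ : t ≤ i), KoszulVanishes polyGrading (monomialIdeal K u T) i j := by
  induction T using Finset.cons_induction with
  | empty =>
    intro t _ u _ i j _
    rw [monomialIdeal_empty]
    exact koszulVanishes_bot _ _ _
  | cons p T hp ih =>
    intro t ht u hu i j hi
    obtain rfl | ⟨t, rfl⟩ : t = 1 ∨ ∃ r, t = r + 1 + 1 :=
      (Nat.lt_or_eq_of_le ht).elim (fun h => Or.inr ⟨t - 2, by omega⟩) fun h => Or.inl h.symm
    · have hv : ∀ k ∈ T.cons p hp, u k = v := fun k hk => by
        simpa using hu {k} (by simpa using hk) (by simp)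
      have hT : monomialIdeal K u (T.cons p hp) = Ideal.span {monomial v (1 : K)} := by
        rw [monomialIdeal]
        congr 1
        ext q
        simp only [Set.mem_image, Finset.mem_coe, exists_exists_and_eq_and, Set.mem_singleton_iff]
        constructor
        · rintro ⟨k, hk, rfl⟩
          rw [hv k hk]
        · rintro rfl
          exact ⟨p, Finset.mem_cons_self p T, by rw [hv p (Finset.mem_cons_self p T)]⟩
      rw [hT]
      exact koszulVanishes_span_monomial _ (Or.inl (by omega))
    -- A set R of one element fewer in the lcm family corresponds to R ∪ {p} in the original one,
    -- with the same lcm.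
    · refine koszulVanishes_monomialIdeal_cons u hp
        (ih _ ht u (fun R hR => hu R (hR.trans (Finset.subset_cons hp))) i j hi)
        (Or.inl (by omega)) (ih (t + 1) (by omega) _ ?_ _ j (by push_cast at hi ⊢; omega))
      intro R hR hc
      have hpR : p ∉ R := fun h => hp (hR h)
      have hne : R.Nonempty := Finset.card_pos.mp (by omega)
      rw [← hu (R.cons p hpR) (Finset.cons_subset_cons.mpr hR) (by rw [Finset.card_cons, hc]),
        Finset.sup_cons, finset_sup_sup_const hne]

/-- The squarefree monomial of a set of variables. -/
def squarefreeExponent (A : Finset (Fin n)) : Fin n →₀ ℕ :=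
  Finsupp.indicator A fun _ _ => 1

theorem squarefreeExponent_union (A B : Finset (Fin n)) :
    squarefreeExponent (A ∪ B) = squarefreeExponent A ⊔ squarefreeExponent B := by
  classical
  ext i
  simp only [squarefreeExponent, Finsupp.indicator_apply, Finsupp.sup_apply, Finset.mem_union]
  by_cases hA : i ∈ A <;> by_cases hB : i ∈ B <;> simp [hA, hB]

theorem degree_squarefreeExponent (A : Finset (Fin n)) :
    (squarefreeExponent A).degree = A.card := by
  classical
  rw [Finsupp.degree_eq_sum]
  simp [squarefreeExponent, Finsupp.indicator_apply]

/-- If `w` bounds from below the number of generators needed to cover all variables in the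
support of a squarefree monomial ideal, then its regularity is at most `N - w + 1`, `N` being the
number of these variables. -/
theorem koszulVanishes_of_cover (T : Finset ι) (hT : T.Nonempty) :
    ∀ (w : ℤ) (U : ι → Finset (Fin n))
      (_ : ∀ R ⊆ T, R.Nonempty → R.sup U = T.sup U → w ≤ R.card) (i j : ℤ)
      (_ : ((T.sup U).card : ℤ) - w + 1 < j - i),
      KoszulVanishes polyGrading (monomialIdeal K (fun k => squarefreeExponent (U k)) T) i j := by
  classical
  induction hT using Finset.Nonempty.cons_induction with
  | singleton p =>
    intro w U hw i j hij
    rw [monomialIdeal_singleton]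
    apply koszulVanishes_span_monomial
    have := hw {p} subset_rfl (Finset.singleton_nonempty p) rfl
    rw [degree_squarefreeExponent]
    simp only [Finset.sup_singleton, Finset.card_singleton] at this hij
    by_contra h
    push Not at h
    omega
  | cons p T hp hT ih =>
    intro w U hw i j hij
    have hcover : ∀ R ⊆ T, U p ∪ R.sup U = U p ∪ T.sup U → w ≤ R.card + 1 := by
      intro R hR h
      have hpR : p ∉ R := fun h => hp (hR h)
      have := hw (R.cons p hpR) (Finset.cons_subset_cons.mpr hR) (Finset.cons_nonempty hpR) (by
        rw [Finset.sup_cons, Finset.sup_cons]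
        exact h)
      rw [Finset.card_cons] at this
      exact_mod_cast this
    rw [Finset.sup_cons, Finset.sup_eq_union] at hij
    -- With N' variables left after dropping p, the bound w - (N - N') leaves N - w + 1 unchanged.
    -- It may be negative, so w is an integer.
    refine koszulVanishes_monomialIdeal_cons _ hp
      (ih (w - (((U p ∪ T.sup U).card : ℤ) - (T.sup U).card)) U ?_ i j (by omega)) ?_ ?_
    -- If p brings no new variable, R already covers everything; otherwise R ∪ {p} does, and N - N'
    -- ≥ 1 absorbs the extra generator.
    · intro R hR hne h
      rcases Nat.eq_or_lt_of_le (Finset.card_le_card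
        (Finset.subset_union_right : T.sup U ⊆ U p ∪ T.sup U)) with h1 | h1
      · have h2 := Finset.eq_of_subset_of_card_le Finset.subset_union_right h1.ge
        have := hw R (hR.trans (Finset.subset_cons hp)) hne (by
          rw [Finset.sup_cons, Finset.sup_eq_union, ← h2, h])
        omega
      · have := hcover R hR (by rw [h])
        omega
    -- If (u_p) contributed, w would exceed 1 plus the number of variables outside U p. But p
    -- together with one generator for each such variable is a cover.
    · by_contra h
      push Not at h
      rw [degree_squarefreeExponent] at h
      have hex : ∀ x ∈ T.sup U, ∃ k ∈ T, x ∈ U k := fun x hx => by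
        simpa [Finset.mem_sup] using hx
      have : Nonempty ι := ⟨p⟩
      choose! c hc hxc using hex
      have := hcover ((T.sup U \ U p).image c)
        (Finset.image_subset_iff.mpr fun x hx => hc x (Finset.mem_sdiff.mp hx).1) (by
          apply subset_antisymm
          · refine Finset.union_subset_union_right (Finset.sup_mono ?_)
            exact Finset.image_subset_iff.mpr fun x hx => hc x (Finset.mem_sdiff.mp hx).1
          · intro x hx
            by_cases hxp : x ∈ U p
            · exact Finset.mem_union_left _ hxp
            · have hxT := (Finset.mem_union.mp hx).resolve_left hxp
              refine Finset.mem_union_right _ (Finset.mem_sup.mpr ⟨c x, ?_, hxc x hxT⟩)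
              exact Finset.mem_image_of_mem _ (Finset.mem_sdiff.mpr ⟨hxT, hxp⟩))
      have h1 : ((T.sup U \ U p).image c).card ≤ (T.sup U \ U p).card := Finset.card_image_le
      have h2 : (U p ∪ T.sup U).card = (U p).card + (T.sup U \ U p).card := by
        rw [← Finset.union_sdiff_self_eq_union, Finset.card_union_of_disjoint Finset.disjoint_sdiff]
      omega
    · have hsup : ∀ R : Finset ι, R.Nonempty → (R.sup fun k => U k ∪ U p) = U p ∪ R.sup U :=
        fun R hR => finset_sup_sup_const hR U (U p)
      simp only [← squarefreeExponent_union]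
      -- Every cover R of the lcm family yields the cover R ∪ {p}. Both N - w + 1 and j - i grow by
      -- one.
      refine ih (w - 1) (fun k => U k ∪ U p) ?_ (i - 1) j (by rw [hsup T hT]; omega)
      intro R hR hne h
      rw [hsup T hT, hsup R hne] at h
      have := hcover R hR h
      omega

end MonomialIdeals

/-! ### Minimal generators, the invariants, and the vanishing ranges -/

section MinimalGenerators

variable {K : Type*} [Field K] {n : ℕ} {I : Ideal (MvPolynomial (Fin n) K)}

theorem mem_minimalGens {u : Fin n →₀ ℕ} :
    u ∈ minimalGens I ↔ Minimal (fun v => monomial v (1 : K) ∈ I) u := by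
  rw [minimalGens, Set.Finite.mem_toFinset]
  rfl

theorem IsSquarefreeMonomialIdeal.le_one (hI : IsSquarefreeMonomialIdeal I) {u : Fin n →₀ ℕ}
    (hu : u ∈ minimalGens I) (i : Fin n) : u i ≤ 1 := by
  obtain ⟨A, hA, rfl⟩ := hI
  rw [mem_minimalGens] at hu
  obtain ⟨a, ha, hau⟩ := mem_ideal_span_monomial_image.mp hu.1 u (by classical simp)
  rw [← hu.eq_of_le (Ideal.subset_span ⟨a, ha, rfl⟩) hau]
  exact hA a ha i

theorem squarefreeExponent_support {u : Fin n →₀ ℕ} (hu : ∀ i, u i ≤ 1) :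
    squarefreeExponent u.support = u := by
  classical
  ext i
  have := hu i
  simp only [squarefreeExponent, Finsupp.indicator_apply, Finsupp.mem_support_iff]
  split_ifs <;> omega

theorem support_squarefreeExponent (A : Finset (Fin n)) : (squarefreeExponent A).support = A := by
  classical
  ext i
  simp [squarefreeExponent, Finsupp.indicator_apply]

theorem IsSquarefreeMonomialIdeal.eq_monomialIdeal (hI : IsSquarefreeMonomialIdeal I) :
    I = monomialIdeal K id (minimalGens I) := by
  apply le_antisymm
  · obtain ⟨A, -, hIA⟩ := hI
    nth_rewrite 1 [hIA]
    rw [Ideal.span_le]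
    rintro _ ⟨a, ha, rfl⟩
    rw [SetLike.mem_coe, mem_monomialIdeal]
    intro m hm
    obtain rfl : m = a := Finset.mem_singleton.mp (support_monomial_subset hm)
    obtain ⟨v, hva, hv⟩ := exists_minimal_le_of_wellFoundedLT
      (fun v => monomial v (1 : K) ∈ I) m (by rw [hIA]; exact Ideal.subset_span ⟨m, ha, rfl⟩)
    exact ⟨v, mem_minimalGens.mpr hv, hva⟩
  · rw [monomialIdeal, Ideal.span_le]
    rintro _ ⟨_, ⟨u, hu, rfl⟩, rfl⟩
    exact (mem_minimalGens.mp hu).1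

theorem IsSquarefreeMonomialIdeal.eq_monomialIdeal_support (hI : IsSquarefreeMonomialIdeal I) :
    I = monomialIdeal K (fun u => squarefreeExponent u.support) (minimalGens I) := by
  nth_rewrite 1 [hI.eq_monomialIdeal]
  rw [monomialIdeal, monomialIdeal]
  congr 2
  exact Set.image_congr fun u hu => (squarefreeExponent_support (hI.le_one hu)).symm

theorem IsSquarefreeMonomialIdeal.monomialLcm_eq (hI : IsSquarefreeMonomialIdeal I)
    {T : Finset (Fin n →₀ ℕ)} (hT : T ⊆ minimalGens I) :
    monomialLcm T = squarefreeExponent (T.biUnion Finsupp.support) := by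
  rw [monomialLcm]
  induction T using Finset.induction_on with
  | empty =>
    ext i
    simp [squarefreeExponent, bot_eq_zero]
  | insert u T hu ih =>
    rw [Finset.sup_insert, Finset.biUnion_insert, squarefreeExponent_union,
      ih fun v hv => hT (Finset.mem_insert_of_mem hv),
      squarefreeExponent_support (hI.le_one (hT (Finset.mem_insert_self u T))), id]

theorem IsSquarefreeMonomialIdeal.monomialLcm_eq_iff (hI : IsSquarefreeMonomialIdeal I)
    {T : Finset (Fin n →₀ ℕ)} (hT : T ⊆ minimalGens I) :
    monomialLcm T = monomialLcm (minimalGens I) ↔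
      T.biUnion Finsupp.support = (minimalGens I).biUnion Finsupp.support := by
  rw [hI.monomialLcm_eq hT, hI.monomialLcm_eq subset_rfl]
  refine ⟨fun h => ?_, fun h => by rw [h]⟩
  rw [← support_squarefreeExponent (T.biUnion _), h, support_squarefreeExponent]

theorem bcos_mem (I : Ideal (MvPolynomial (Fin n) K)) :
    1 ≤ bcos I ∧ ∀ T ⊆ minimalGens I, T.card = bcos I →
      monomialLcm T = monomialLcm (minimalGens I) :=
  Nat.sInf_mem (s := {l | 1 ≤ l ∧ ∀ T ⊆ minimalGens I, T.card = l →
    monomialLcm T = monomialLcm (minimalGens I)})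
    -- No subset has this many elements, so the condition holds vacuously, also for the zero ideal.
    ⟨(minimalGens I).card + 1, by omega, fun T hT h => by
      have := Finset.card_le_card hT
      omega⟩

/-- A squarefree lcm is determined by the union of the supports, so the two conditions agree up to
the shift ℓ = i + 1; the bound 1 ≤ bcos lets the infimum be shifted. -/
theorem IsSquarefreeMonomialIdeal.supportIndex_add_one (hI : IsSquarefreeMonomialIdeal I) :
    supportIndex I + 1 = bcos I := by
  rw [bcos, ← Nat.sInf_add (n := 1) (bcos_mem I).1, supportIndex]
  congr 2
  ext i
  constructor
  · intro h
    exact ⟨by omega, fun T hT hc => (hI.monomialLcm_eq_iff hT).mpr (h _ ⟨T, hT, hc, rfl⟩)⟩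
  · rintro ⟨-, h⟩ _ ⟨T, hT, hc, rfl⟩
    exact (hI.monomialLcm_eq_iff hT).mp (h T hT hc)

theorem IsSquarefreeMonomialIdeal.koszulVanishes_of_bcos_le (hI : IsSquarefreeMonomialIdeal I)
    {i : ℤ} (hi : bcos I ≤ i) (j : ℤ) : KoszulVanishes polyGrading I i j := by
  rw [hI.eq_monomialIdeal]
  exact koszulVanishes_of_sup_eq _ _ _ (bcos_mem I).1 id (bcos_mem I).2 i j hi

theorem IsSquarefreeMonomialIdeal.koszulVanishes_of_cosize_lt (hI : IsSquarefreeMonomialIdeal I)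
    {i j : ℤ} (hij : cosize I + 1 < j - i) : KoszulVanishes polyGrading I i j := by
  classical
  -- The zero ideal has no nonempty cover and is treated apart.
  rcases (minimalGens I).eq_empty_or_nonempty with h0 | hne
  · rw [hI.eq_monomialIdeal, h0, monomialIdeal_empty]
    exact koszulVanishes_bot _ _ _
  · rw [hI.eq_monomialIdeal_support]
    refine koszulVanishes_of_cover _ hne (minCoverSize I) Finsupp.support ?_ i j ?_
    · intro R hR hRne h
      rw [Finset.sup_eq_biUnion, Finset.sup_eq_biUnion] at h
      have : minCoverSize I ≤ R.card :=
        Nat.sInf_le ⟨hRne.card_pos, R, hR, rfl, (hI.monomialLcm_eq_iff hR).mpr (by convert h)⟩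
      exact_mod_cast this
    · rw [cosize, hI.monomialLcm_eq subset_rfl, degree_squarefreeExponent] at hij
      rw [Finset.sup_eq_biUnion]
      convert hij

theorem gradedBetti_eq_zero {I : HomogeneousIdeal (homogeneousSubmodule (Fin n) K)} {i j : ℕ}
    (h : KoszulVanishes polyGrading I.toIdeal i j) : gradedBetti I i j = 0 :=
  GradedFreeResolution.IsMinimal.betti_eq_zero (exists_minimal_resolution I).choose_spec h

end MinimalGenerators

end

end SquarefreeBounds

theorem mainTheorem2 {K : Type*} [Field K] {n : ℕ}
    (I : HomogeneousIdeal (MvPolynomial.homogeneousSubmodule (Fin n) K))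
    (hI : SquarefreeBounds.IsSquarefreeMonomialIdeal I.toIdeal) :
    (SquarefreeBounds.supportIndex I.toIdeal : ℤ) =
        (SquarefreeBounds.bcos I.toIdeal : ℤ) - 1 ∧
    SquarefreeBounds.projDim I ≤
        ((min (SquarefreeBounds.supportIndex I.toIdeal) n : ℕ) : WithBot ℕ∞) ∧
    SquarefreeBounds.regularity I ≤
        (((SquarefreeBounds.cosize I.toIdeal + 1 : ℤ) : WithTop ℤ) : WithBot (WithTop ℤ)) := by
  have hs := hI.supportIndex_add_one
  refine ⟨by omega, sSup_le ?_, sSup_le ?_⟩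
  · rintro _ ⟨i, j, hij, rfl⟩
    have h1 : i ≤ SquarefreeBounds.supportIndex I.toIdeal := by
      by_contra h
      exact hij (SquarefreeBounds.gradedBetti_eq_zero
        (hI.koszulVanishes_of_bcos_le (by omega) _))
    have h2 : i ≤ n := by
      by_contra h
      exact hij (SquarefreeBounds.gradedBetti_eq_zero
        (SquarefreeBounds.koszulVanishes_of_length_lt _ _ (by omega) _))
    exact_mod_cast le_min h1 h2
  · rintro _ ⟨i, j, hij, rfl⟩
    rw [WithBot.coe_le_coe, WithTop.coe_le_coe]
    by_contra h
    exact hij (SquarefreeBounds.gradedBetti_eq_zero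
      (hI.koszulVanishes_of_cosize_lt (not_le.mp h)))
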